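/- Let $n\ge 1$ be the number of qubits and $D=2^n$. Let $$\sigma_0=\begin{pmatrix}1&0\\0&1\end{pmatrix},\quad \sigma_1=\begin{pmatrix}0&1\\1&0\end{pmatrix},\quad \sigma_2=\begin{pmatrix}0&i\\-i&0\end{pmatrix},\quad \sigma_3=\begin{pmatrix}1&0\\0&-1\end{pmatrix}.$$ For $w=(w_1,\dots,w_n)\in\{0,1,2,3\}^n$ let $W_w=\sigma_{w_1}\otimes\cdots\otimes\sigma_{w_n}\in\mathbb C^{D\times D}$; these are the $D^2$ Pauli matrices. For $i=1,2,3$ let $E_i^{+}$ and $E_i^{-}$ be the orthogonal projections onto the eigenspaces of $\sigma_i$ for the eigenvalues $+1$ and $-1$, and let $E_0^\pm=E_3^\pm$, so that $\sigma_i=E_i^++\widehat\alpha_iE_i^-$ with $\widehat\alpha_0=1$, $\widehat\alpha_1=\widehat\alpha_2=\widehat\alpha_3=-1$. Expanding the tensor product gives $W_w=\sum_{j=1}^D\alpha_{w,j}E_{w,j}$ with $\alpha_{w,j}\in\{\pm1\}$, where the $D$ matrices $E_{w,j}$ are the products $E_{w_1}^\pm\otimes\cdots\otimes E_{w_n}^\pm$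 and form a POVM. Write $\langle A,B\rangle=\operatorname{trace}(A^{\mathsf H}B)$, and let $\|\cdot\|$ be the spectral norm. Let $\rho^\star\in\mathbb C^{D\times D}$ be a density matrix (positive semidefinite with trace $1$), and let $K,M\ge1$ be integers. Draw labels $w^{(1)},\dots,w^{(K)}$ independently and uniformly from $\{0,1,2,3\}^n$, and put $A_k=W_{w^{(k)}}$. Given the labels, measure $\rho^\star$ with each POVM $\{E_{w^{(k)},j}\}_{j}$ exactly $M$ times, all outcomes being independent and the outcome $j$ having probability $\langle E_{w^{(k)},j},\rho^\star\rangle$. Let $f_{k,j}$ be the number of times that the outcome $j$ occurs among the $M$ measurements with the $k$-th POVM, and let $$\widehat y_k=\sum_{j=1}^D\alpha_{w^{(k)},j}\,\frac{f_{k,j}}{M},\qquad e_k=\widehat y_k-\langle A_k,\rho^\star\rangle,\qquad \mathcal A^*(e)=\sum_{k=1}^K e_kA_k .$$ **Lemma.** There is a universal constant $c>0$ such that for every $C_0>0$ there is a constant $C>0$, depending only on $C_0$, with the following property. For all integers $n,K,M\ge1$ with $M\le C_0K/n$ and every density matrix $\rho^\star\in\mathbb C^{D\times D}$, with probability at least $$1-\exp\left(-\frac{c\,n}{1+\sqrt{Mn/K}}\right)$$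 (over both the choice of the labels and the measurement outcomes), $$\frac{\|\mathcal A^*(e)\|}{K}\le C\sqrt{\frac{\log D}{KM}} .$$ -/

import Mathlib

open MeasureTheory ProbabilityTheory
open scoped ComplexOrder

namespace PauliTomography

noncomputable section

/-- Labels `(k_1, …, k_n) ∈ {0,1,2,3}^n` of the `4^n = D^2` Pauli matrices on `n` qubits. -/
abbrev PauliIndex (n : ℕ) : Type := Fin n → Fin 4

/-- The computational basis of the `n`-qubit space; it has `D = 2^n` elements and indexes the rows
and columns of `D × D` matrices. -/
abbrev Qubits (n : ℕ) : Type := Fin n → Fin 2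

/-- The `D = 2^n` outcomes of a Pauli basis measurement: one sign per qubit,
where `0` stands for `+` and `1` stands for `-`. -/
abbrev Outcome (n : ℕ) : Type := Fin n → Fin 2

/-- A density matrix: positive semidefinite of unit trace. -/
structure IsDensityMatrix {n : ℕ} (ρ : Matrix (Qubits n) (Qubits n) ℂ) : Prop where
  posSemidef : ρ.PosSemidef
  trace_eq_one : ρ.trace = 1

/-- The inner product `⟨A, B⟩ = trace (Aᴴ B)`. For Hermitian `A` and `B`, the only
case used below, `trace (Aᴴ B)` is real, so that taking the real part is only a coercion to `ℝ`. -/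
def innerRe {n : ℕ} (A B : Matrix (Qubits n) (Qubits n) ℂ) : ℝ :=
  (A.conjTranspose * B).trace.re

/-- The spectral norm of a matrix: its operator norm for the Euclidean norm on `ℂ^D`. -/
def specNorm {n : ℕ} (A : Matrix (Qubits n) (Qubits n) ℂ) : ℝ :=
  ‖Matrix.toEuclideanCLM (n := Qubits n) (𝕜 := ℂ) A‖

/-- The single-qubit matrices `σ_0, σ_1, σ_2, σ_3`. -/
def sigma : Fin 4 → Matrix (Fin 2) (Fin 2) ℂ :=
  ![!![1, 0; 0, 1],
    !![0, 1; 1, 0],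
    !![0, Complex.I; -Complex.I, 0],
    !![1, 0; 0, -1]]

/-- The `n`-fold tensor product of `2 × 2` matrices. -/
def tensor {n : ℕ} (B : Fin n → Matrix (Fin 2) (Fin 2) ℂ) : Matrix (Qubits n) (Qubits n) ℂ :=
  Matrix.of fun i j => ∏ l, B l (i l) (j l)

/-- The Pauli matrix `W_w = σ_{w_1} ⊗ ⋯ ⊗ σ_{w_n}`. -/
def pauli {n : ℕ} (w : PauliIndex n) : Matrix (Qubits n) (Qubits n) ℂ :=
  tensor fun l => sigma (w l)

/-- The number `1 / √2`. -/
def invSqrtTwo : ℂ := ((1 / Real.sqrt 2 : ℝ) : ℂ)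

/-- `localVec i s` is the unit vector onto which the local measurement operator `E_i^±` projects
(`s = 0` for `+`, `s = 1` for `-`); for `i = 0` the vectors for `i = 3` are used. -/
def localVec : Fin 4 → Fin 2 → Fin 2 → ℂ :=
  ![![![1, 0], ![0, 1]],
    ![![invSqrtTwo, invSqrtTwo], ![invSqrtTwo, -invSqrtTwo]],
    ![![invSqrtTwo, -(Complex.I * invSqrtTwo)], ![invSqrtTwo, Complex.I * invSqrtTwo]],
    ![![1, 0], ![0, 1]]]

/-- The local measurement operators `E_i^+` (`s = 0`) and `E_i^-` (`s = 1`). -/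
def localPOVM (i : Fin 4) (s : Fin 2) : Matrix (Fin 2) (Fin 2) ℂ :=
  Matrix.vecMulVec (localVec i s) (star (localVec i s))

/-- The coefficients in `σ_i = E_i^+ + α̂_i E_i^-`: the coefficient of `E_i^+` is `1`, and
`α̂_0 = 1`, `α̂_1 = α̂_2 = α̂_3 = -1`. -/
def localCoeff (i : Fin 4) (s : Fin 2) : ℝ :=
  if s = 0 then 1 else (![1, -1, -1, -1] : Fin 4 → ℝ) i

/-- The elements `E_{w,j} = E_{w_1}^± ⊗ ⋯ ⊗ E_{w_n}^±` of the `D`-outcome POVM which measures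
`W_w`. -/
def povm {n : ℕ} (w : PauliIndex n) (j : Outcome n) : Matrix (Qubits n) (Qubits n) ℂ :=
  tensor fun l => localPOVM (w l) (j l)

/-- The signs `α_{w,j}` in `W_w = ∑_j α_{w,j} E_{w,j}`. -/
def coeff {n : ℕ} (w : PauliIndex n) (j : Outcome n) : ℝ :=
  ∏ l, localCoeff (w l) (j l)

/-- The probability `p_{w,j} = ⟨E_{w,j}, ρ⟩` of the outcome `j` when the state `ρ` is measured with
the POVM `{E_{w,j}}_j`. -/
def outcomeProb {n : ℕ} (ρ : Matrix (Qubits n) (Qubits n) ℂ) (w : PauliIndex n) (j : Outcome n) :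
    ℝ :=
  innerRe (povm w j) ρ

/-- The measurement operator `𝒜(ρ) = (⟨A_1, ρ⟩, …, ⟨A_K, ρ⟩)`, where `A_k = W_{w k}`. -/
def measure {n K : ℕ} (w : Fin K → PauliIndex n) (ρ : Matrix (Qubits n) (Qubits n) ℂ) :
    Fin K → ℝ :=
  fun k => innerRe (pauli (w k)) ρ

/-- The adjoint `𝒜^*(x) = ∑_k x_k A_k`, where `A_k = W_{w k}`. -/
def measureAdjoint {n K : ℕ} (w : Fin K → PauliIndex n) (x : Fin K → ℝ) :
    Matrix (Qubits n) (Qubits n) ℂ :=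
  ∑ k, (x k : ℂ) • pauli (w k)

/-- The number `f_j` of times that the outcome `j` occurs among the `M` outcomes `o`. -/
def frequency {n M : ℕ} (o : Fin M → Outcome n) (j : Outcome n) : ℕ :=
  (Finset.univ.filter fun m => o m = j).card

/-- The empirical probability `p̂_j = f_j / M`. -/
def empiricalProb {n M : ℕ} (o : Fin M → Outcome n) (j : Outcome n) : ℝ :=
  (frequency o j : ℝ) / M

/-- The empirical Pauli observable measurements `ŷ_k = ∑_j α_{k,j} p̂_{k,j}`. -/
def empiricalMeasure {n K M : ℕ} (w : Fin K → PauliIndex n) (o : Fin K → Fin M → Outcome n) :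
    Fin K → ℝ :=
  fun k => ∑ j, coeff (w k) j * empiricalProb (o k) j

/-- The statistical error `e = ŷ - y`, where `y = 𝒜(ρ)`. -/
def statError {n K M : ℕ} (ρ : Matrix (Qubits n) (Qubits n) ℂ) (w : Fin K → PauliIndex n)
    (o : Fin K → Fin M → Outcome n) : Fin K → ℝ :=
  fun k => empiricalMeasure w o k - measure w ρ k

/-- The random experiment: labels `a k` (`k = 1, …, K`) of Pauli matrices are drawn independently
and uniformly, and given these labels all the outcomes `o k m` (`k = 1, …, K`, `m = 1, …, M`) are
independent, `o k m` being the outcome of measuring `ρ` with the POVM that belongs to `a k`. -/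
structure IsPauliExperiment {n K M : ℕ} {Ω : Type*} [MeasurableSpace Ω] (P : Measure Ω)
    (ρ : Matrix (Qubits n) (Qubits n) ℂ) (a : Fin K → Ω → PauliIndex n)
    (o : Fin K → Fin M → Ω → Outcome n) : Prop where
  measurable_label : ∀ k, Measurable (a k)
  measurable_outcome : ∀ k m, Measurable (o k m)
  label_indep : iIndepFun a P
  label_uniform : ∀ k w, P.real {ω | a k ω = w} = 1 / (4 : ℝ) ^ n
  outcome_law : ∀ (w : Fin K → PauliIndex n) (x : Fin K → Fin M → Outcome n),
    P.real {ω | (∀ k, a k ω = w k) ∧ ∀ k m, o k m ω = x k m} =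
      P.real {ω | ∀ k, a k ω = w k} * ∏ k, ∏ m, outcomeProb ρ (w k) (x k m)

end

end PauliTomography

open PauliTomography

/-! ### Second-order perturbation of the trace of `cosh` -/

section TraceCosh

variable {E : Type*} [NormedAddCommGroup E] [InnerProductSpace ℂ E]

/-! The proof is a matrix Laplace transform argument with `tr cosh` as potential. Each Pauli matrix
is a Hermitian unitary, so the summand `e_k A_k` is `|e_k|` times an isometry. For such a
perturbation `B` of a Hermitian `H`, with `‖B x‖ = b ‖x‖` and `b ≤ 1/4`, expanding in eigenbases of
`H` and `H + B` gives `tr cosh (H + B) ≤ (1 + 3 b²) tr cosh H + L B` with `L` real-linear and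
depending only on `H` (`sum_cosh_le_of_eigenbases`, `exists_traceCosh_add_le`). This elementary
Klein-type estimate takes the place of Golden-Thompson or Lieb.

Given its label, `e_k` is centred, has variance at most `1/M` and satisfies `|e_k| ≤ 2`. The linear
term therefore averages out, and by induction on `K` the mean of `tr cosh (θ 𝒜^*(e))` is at most `D
(1 + 3θ²/M)^K` for `θ ≤ 1/8`. Markov's inequality bounds the probability of `‖𝒜^*(e)‖ > t` by `2D
exp (3θ²K/M - θt)` (`sum_blockWeight_filter_le`). With `θ` proportional to `√(Mn/K)`, which `M ≤
C₀K/n` keeps bounded, and `θt = 3n`, this is at most `exp (-n)`. -/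

theorem exp_sub_one_sub_id_le (x : ℝ) :
    Real.exp x - 1 - x ≤ x ^ 2 * (1 + Real.exp x) := by
  have hpos := Real.exp_pos x
  rcases le_total |x| 1 with h | h
  · have h1 := le_of_abs_le (Real.abs_exp_sub_one_sub_id_le h)
    nlinarith [mul_nonneg (sq_nonneg x) hpos.le]
  · have h2 : 1 ≤ x ^ 2 := (one_le_sq_iff_one_le_abs x).mpr h
    have h3 : |x| ≤ x ^ 2 := by nlinarith [sq_abs x]
    have h4 := neg_abs_le x
    nlinarith [mul_nonneg (sub_nonneg.mpr h2) hpos.le]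

/-- A second-order Taylor bound for `exp` with the two endpoints as weights. -/
theorem exp_bregman_le (μ l : ℝ) :
    Real.exp μ - Real.exp l - (μ - l) * Real.exp l ≤
      (μ - l) ^ 2 * (Real.exp l + Real.exp μ) := by
  have h := mul_le_mul_of_nonneg_left (exp_sub_one_sub_id_le (μ - l)) (Real.exp_pos l).le
  have h2 : Real.exp μ = Real.exp l * Real.exp (μ - l) := by
    rw [← Real.exp_add]; ring_nf
  rw [h2]
  linarith

/-- The remainder is controlled by endpoint values, not by an intermediate point, so that each term
keeps a `cosh` of one eigenvalue only and the double sum over two spectra factors. -/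
theorem cosh_bregman_le (μ l : ℝ) :
    Real.cosh μ - Real.cosh l - (μ - l) * Real.sinh l ≤
      (μ - l) ^ 2 * (Real.cosh l + Real.cosh μ) := by
  have h1 := exp_bregman_le μ l
  have h2 := exp_bregman_le (-μ) (-l)
  rw [Real.cosh_eq, Real.cosh_eq, Real.sinh_eq]
  linarith

/-- Moving `G` to the left factor turns both operators into scalars. This dictionary transfers
scalar inequalities in `μ` and `l` to `G` and `H` without their commuting. -/
theorem inner_perturbation {G H : E →ₗ[ℂ] E} (hG : G.IsSymmetric) {u v : E} {μ l : ℝ}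
    (hu : G u = (μ : ℂ) • u) (hv : H v = (l : ℂ) • v) :
    inner ℂ u ((G - H) v) = ((μ - l : ℝ) : ℂ) * inner ℂ u v := by
  rw [LinearMap.sub_apply, inner_sub_right, ← hG u v, hu, hv, inner_smul_left, inner_smul_right]
  simp
  ring

theorem norm_inner_perturbation_sq {G H : E →ₗ[ℂ] E} (hG : G.IsSymmetric) {u v : E} {μ l : ℝ}
    (hu : G u = (μ : ℂ) • u) (hv : H v = (l : ℂ) • v) :
    ‖inner ℂ u ((G - H) v)‖ ^ 2 = ‖inner ℂ u v‖ ^ 2 * (μ - l) ^ 2 := by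
  rw [inner_perturbation hG hu hv, norm_mul, mul_pow, Complex.norm_real, Real.norm_eq_abs, sq_abs,
    mul_comm]

theorem re_inner_perturbation {ι : Type*} [Fintype ι] (u : OrthonormalBasis ι ℂ E)
    {G H : E →ₗ[ℂ] E} (hG : G.IsSymmetric) {μ : ι → ℝ} (hu : ∀ i, G (u i) = (μ i : ℂ) • u i)
    {v : E} {l : ℝ} (hv : H v = (l : ℂ) • v) :
    (inner ℂ v ((G - H) v)).re = ∑ i, ‖inner ℂ (u i) v‖ ^ 2 * (μ i - l) := by
  rw [← u.sum_inner_mul_inner v, Complex.re_sum]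
  refine Finset.sum_congr rfl fun i _ => ?_
  rw [inner_perturbation hG (hu i) hv, mul_left_comm, ← inner_conj_symm v, Complex.conj_mul',
    ← Complex.ofReal_pow, ← Complex.ofReal_mul, Complex.ofReal_re, mul_comm]

theorem sum_overlap_mul_sq {ι : Type*} [Fintype ι] (u : OrthonormalBasis ι ℂ E)
    {G H : E →ₗ[ℂ] E} (hG : G.IsSymmetric) {μ : ι → ℝ} (hu : ∀ i, G (u i) = (μ i : ℂ) • u i)
    {v : E} {l : ℝ} (hv : H v = (l : ℂ) • v) :
    ∑ i, ‖inner ℂ (u i) v‖ ^ 2 * (μ i - l) ^ 2 = ‖(G - H) v‖ ^ 2 := by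
  rw [← u.sum_sq_norm_inner_right]
  exact Finset.sum_congr rfl fun i _ => (norm_inner_perturbation_sq hG (hu i) hv).symm

/-- A Klein-type inequality: second-order expansion of `tr cosh` along a perturbation `G - H` that
is a multiple of an isometry, in terms of eigenbases of `G` and `H`. -/
theorem sum_cosh_le_of_eigenbases {ι κ : Type*} [Fintype ι] [Fintype κ]
    (u : OrthonormalBasis ι ℂ E) (v : OrthonormalBasis κ ℂ E)
    {G H : E →ₗ[ℂ] E} (hG : G.IsSymmetric) (hH : H.IsSymmetric) {μ : ι → ℝ} {l : κ → ℝ}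
    (hu : ∀ i, G (u i) = (μ i : ℂ) • u i) (hv : ∀ j, H (v j) = (l j : ℂ) • v j)
    {b : ℝ} (hb : ∀ x, ‖(G - H) x‖ = b * ‖x‖) :
    ∑ i, Real.cosh (μ i) ≤ ∑ j, Real.cosh (l j)
      + ∑ j, Real.sinh (l j) * (inner ℂ (v j) ((G - H) (v j))).re
      + b ^ 2 * (∑ j, Real.cosh (l j) + ∑ i, Real.cosh (μ i)) := by
  have hb' : ∀ x, ‖(H - G) x‖ = b * ‖x‖ := fun x => by
    rw [← hb x, ← norm_neg, ← LinearMap.neg_apply, neg_sub]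
  have hsymm : ∀ i j, ‖inner ℂ (v j) (u i)‖ = ‖inner ℂ (u i) (v j)‖ := fun i j =>
    norm_inner_symm _ _
  -- The squared overlaps form a doubly stochastic matrix.
  have hrow : ∀ i, ∑ j, ‖inner ℂ (u i) (v j)‖ ^ 2 = 1 := fun i => by
    simp_rw [← hsymm]
    rw [v.sum_sq_norm_inner_right, u.norm_eq_one, one_pow]
  have hcol : ∀ j, ∑ i, ‖inner ℂ (u i) (v j)‖ ^ 2 = 1 := fun j => by
    rw [u.sum_sq_norm_inner_right, v.norm_eq_one, one_pow]
  -- The isometry hypothesis enters here: the row sums are `‖(H - G) u_i‖²` and the column sums `‖(G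
  -- - H) v_j‖²`, all equal to `b²`.
  have hrow2 : ∀ i, ∑ j, ‖inner ℂ (u i) (v j)‖ ^ 2 * (μ i - l j) ^ 2 = b ^ 2 := fun i => by
    have h := sum_overlap_mul_sq v hH hv (hu i)
    rw [hb', u.norm_eq_one, mul_one] at h
    rw [← h]
    exact Finset.sum_congr rfl fun j _ => by rw [hsymm]; ring
  have hcol2 : ∀ j, ∑ i, ‖inner ℂ (u i) (v j)‖ ^ 2 * (μ i - l j) ^ 2 = b ^ 2 := fun j => by
    rw [sum_overlap_mul_sq u hG hu (hv j), hb, v.norm_eq_one, mul_one]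
  have key : ∑ j, ∑ i, ‖inner ℂ (u i) (v j)‖ ^ 2 *
        (Real.cosh (μ i) - Real.cosh (l j) - (μ i - l j) * Real.sinh (l j)) ≤
      ∑ j, ∑ i, ‖inner ℂ (u i) (v j)‖ ^ 2 *
        ((μ i - l j) ^ 2 * (Real.cosh (l j) + Real.cosh (μ i))) := by
    gcongr
    exact cosh_bregman_le _ _
  have e1 : ∑ j, ∑ i, ‖inner ℂ (u i) (v j)‖ ^ 2 * Real.cosh (μ i) = ∑ i, Real.cosh (μ i) := by
    rw [Finset.sum_comm]
    simp_rw [← Finset.sum_mul, hrow, one_mul]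
  have e2 : ∑ j, ∑ i, ‖inner ℂ (u i) (v j)‖ ^ 2 * Real.cosh (l j) = ∑ j, Real.cosh (l j) := by
    simp_rw [← Finset.sum_mul, hcol, one_mul]
  have e3 : ∑ j, ∑ i, ‖inner ℂ (u i) (v j)‖ ^ 2 * ((μ i - l j) * Real.sinh (l j)) =
      ∑ j, Real.sinh (l j) * (inner ℂ (v j) ((G - H) (v j))).re := by
    refine Finset.sum_congr rfl fun j _ => ?_
    rw [re_inner_perturbation u hG hu (hv j), Finset.mul_sum]
    exact Finset.sum_congr rfl fun i _ => by ring
  have e4 : ∑ j, ∑ i, ‖inner ℂ (u i) (v j)‖ ^ 2 * ((μ i - l j) ^ 2 * Real.cosh (l j)) =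
      b ^ 2 * ∑ j, Real.cosh (l j) := by
    simp_rw [← mul_assoc, ← Finset.sum_mul, hcol2, ← Finset.mul_sum]
  have e5 : ∑ j, ∑ i, ‖inner ℂ (u i) (v j)‖ ^ 2 * ((μ i - l j) ^ 2 * Real.cosh (μ i)) =
      b ^ 2 * ∑ i, Real.cosh (μ i) := by
    rw [Finset.sum_comm]
    simp_rw [← mul_assoc, ← Finset.sum_mul, hrow2, ← Finset.mul_sum]
  simp_rw [mul_sub, mul_add, Finset.sum_sub_distrib, Finset.sum_add_distrib] at key
  rw [e1, e2, e3, e4, e5] at key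
  linarith

variable [FiniteDimensional ℂ E]

open Classical in
/-- The trace of `cosh T` for a symmetric operator `T`. -/
noncomputable def traceCosh (T : E →ₗ[ℂ] E) : ℝ :=
  if h : T.IsSymmetric then ∑ i, Real.cosh (h.eigenvalues rfl i) else 0

theorem traceCosh_eq {T : E →ₗ[ℂ] E} (h : T.IsSymmetric) :
    traceCosh T = ∑ i, Real.cosh (h.eigenvalues rfl i) := dif_pos h

theorem traceCosh_zero : traceCosh (0 : E →ₗ[ℂ] E) = Module.finrank ℂ E := by
  have h : (0 : E →ₗ[ℂ] E).IsSymmetric := LinearMap.IsSymmetric.zero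
  have h0 : ∀ i, h.eigenvalues rfl i = 0 := fun i => by
    have h1 := h.apply_eigenvectorBasis rfl i
    rw [LinearMap.zero_apply, eq_comm, smul_eq_zero] at h1
    exact Complex.ofReal_eq_zero.mp (h1.resolve_right
      ((h.eigenvectorBasis rfl).orthonormal.ne_zero i))
  rw [traceCosh_eq h]
  simp [h0]

/-- One step of the matrix Laplace transform method: up to a term that is linear in `B`, adding a
small multiple `B` of an isometry to `H` increases `tr cosh` by a factor of at most
`1 + 3 b ^ 2`. -/
theorem exists_traceCosh_add_le {H : E →ₗ[ℂ] E} (hH : H.IsSymmetric) :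
    ∃ L : (E →ₗ[ℂ] E) →ₗ[ℝ] ℝ, ∀ (B : E →ₗ[ℂ] E) (b : ℝ), B.IsSymmetric →
      (∀ x, ‖B x‖ = b * ‖x‖) → 0 ≤ b → b ≤ 1 / 4 →
      traceCosh (H + B) ≤ (1 + 3 * b ^ 2) * traceCosh H + L B := by
  set v := hH.eigenvectorBasis rfl
  set l := hH.eigenvalues rfl
  refine ⟨{ toFun := fun B => ∑ j, Real.sinh (l j) * (inner ℂ (v j) (B (v j))).re
            map_add' := fun A B => by
              simp [mul_add, Finset.sum_add_distrib]
            map_smul' := fun r B => by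
              simp only [LinearMap.smul_apply, RingHom.id_apply, smul_eq_mul, Finset.mul_sum]
              refine Finset.sum_congr rfl fun j _ => ?_
              rw [← Complex.coe_smul, inner_smul_right, Complex.re_ofReal_mul]
              ring }, fun B b hB hBx hb hb4 => ?_⟩
  have hG : (H + B).IsSymmetric := hH.add hB
  have h1 := sum_cosh_le_of_eigenbases (hG.eigenvectorBasis rfl) v hG hH
    (μ := hG.eigenvalues rfl) (l := l)
    (hG.apply_eigenvectorBasis rfl) (hH.apply_eigenvectorBasis rfl) (b := b)
    (by simpa using hBx)
  rw [← traceCosh_eq hG, ← traceCosh_eq hH, add_sub_cancel_left] at h1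
  change _ ≤ _ + ∑ j, Real.sinh (l j) * (inner ℂ (v j) (B (v j))).re
  -- A crude bound on the linear term, used only to get `tr cosh (H + B) ≤ 2 tr cosh H`. Inserting
  -- that into the `b²` term of `h1` produces the factor 3.
  have h2 : ∑ j, Real.sinh (l j) * (inner ℂ (v j) (B (v j))).re ≤ b * traceCosh H := by
    rw [traceCosh_eq hH, Finset.mul_sum]
    refine Finset.sum_le_sum fun j _ => ?_
    have h3 : |(inner ℂ (v j) (B (v j))).re| ≤ b := by
      refine (Complex.abs_re_le_norm _).trans ((norm_inner_le_norm _ _).trans ?_)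
      rw [hBx, v.norm_eq_one, mul_one, one_mul]
    have h4 : |Real.sinh (l j)| ≤ Real.cosh (l j) := by
      refine abs_le.mpr ⟨?_, (Real.sinh_lt_cosh _).le⟩
      have := Real.sinh_lt_cosh (-l j)
      rw [Real.sinh_neg, Real.cosh_neg] at this
      linarith
    calc _ ≤ |Real.sinh (l j)| * |(inner ℂ (v j) (B (v j))).re| := by
          rw [← abs_mul]; exact le_abs_self _
      _ ≤ Real.cosh (l j) * b := by gcongr
      _ = _ := mul_comm _ _
  have hpos : 0 ≤ traceCosh H := by
    rw [traceCosh_eq hH]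
    exact Finset.sum_nonneg fun _ _ => (Real.cosh_pos _).le
  have hb2 : b ^ 2 ≤ 1 / 16 := by nlinarith
  have h5 : traceCosh (H + B) ≤ 2 * traceCosh H := by
    by_contra! hlt
    nlinarith [mul_nonneg (sub_nonneg.mpr hb4) hpos, mul_nonneg (sub_nonneg.mpr hb2) hpos,
      mul_nonneg (sub_nonneg.mpr hb2) (sub_nonneg.mpr hlt.le)]
  nlinarith [mul_le_mul_of_nonneg_left h5 (sq_nonneg b)]

/-- All summands of the trace are positive, so a trace below `cosh r` confines every eigenvalue to
`[-r, r]`. Since `cosh` is even, both ends of the spectrum are handled at once. -/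
theorem cosh_opNorm_le_traceCosh {T : E →L[ℂ] E} (hT : (T : E →ₗ[ℂ] E).IsSymmetric) {r : ℝ}
    (hr : 0 ≤ r) (h : r < ‖T‖) : Real.cosh r ≤ traceCosh (T : E →ₗ[ℂ] E) := by
  by_contra! hlt
  refine h.not_ge (T.opNorm_le_bound hr fun x => ?_)
  set v := hT.eigenvectorBasis rfl
  set l := hT.eigenvalues rfl
  have hl : ∀ i, |l i| ≤ r := fun i => by
    have h1 : Real.cosh (l i) ≤ traceCosh (T : E →ₗ[ℂ] E) := by
      rw [traceCosh_eq hT]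
      exact Finset.single_le_sum (f := fun i => Real.cosh (l i))
        (fun _ _ => (Real.cosh_pos _).le) (Finset.mem_univ i)
    rw [← abs_of_nonneg hr]
    exact Real.cosh_le_cosh.mp (h1.trans hlt.le)
  refine le_of_sq_le_sq ?_ (by positivity)
  rw [mul_pow, ← v.sum_sq_norm_inner_right, ← v.sum_sq_norm_inner_right x, Finset.mul_sum]
  refine Finset.sum_le_sum fun i _ => ?_
  have h2 : inner ℂ (v i) (T x) = (l i : ℂ) * inner ℂ (v i) x := by
    have := hT (v i) x
    rw [hT.apply_eigenvectorBasis rfl i] at this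
    rw [← ContinuousLinearMap.coe_coe, ← this, inner_smul_left]
    exact congrArg (· * _) (Complex.conj_ofReal _)
  rw [h2, norm_mul, mul_pow, Complex.norm_real, Real.norm_eq_abs]
  gcongr
  exact hl i

end TraceCosh

/-! ### Moments and tail bounds under finite product weights -/

section FiniteProductWeights

theorem sum_fin_succ_pi {Z R : Type*} [Fintype Z] [AddCommMonoid R] {K : ℕ}
    (F : (Fin (K + 1) → Z) → R) :
    ∑ z, F z = ∑ z : Fin K → Z, ∑ y, F (Fin.cons y z) := by
  rw [← (Fin.consEquiv fun _ => Z).sum_comp, Fintype.sum_prod_type_right]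
  rfl

variable {Z : Type*} [Fintype Z] {q : Z → ℝ}

theorem sum_prod_weight (hq1 : ∑ z, q z = 1) (K : ℕ) :
    ∑ z : Fin K → Z, ∏ k, q (z k) = 1 := by
  rw [← Fintype.sum_pow, hq1, one_pow]

theorem sum_prod_weight_mul_sum (hq1 : ∑ z, q z = 1) {g : Z → ℝ} (hg : ∑ z, q z * g z = 0)
    (K : ℕ) : ∑ z : Fin K → Z, (∏ k, q (z k)) * ∑ k, g (z k) = 0 := by
  induction K with
  | zero => simp
  | succ K ih =>
    rw [sum_fin_succ_pi, ← ih]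
    refine Finset.sum_congr rfl fun z _ => ?_
    simp only [Fin.prod_univ_succ, Fin.sum_univ_succ, Fin.cons_zero, Fin.cons_succ]
    calc _ = ∑ y, ((q y * g y) * (∏ k, q (z k))
            + q y * ((∏ k, q (z k)) * ∑ k, g (z k))) :=
          Finset.sum_congr rfl fun y _ => by ring
      _ = _ := by rw [Finset.sum_add_distrib, ← Finset.sum_mul, ← Finset.sum_mul, hg, hq1]; ring

/-- The second moment of a sum of independent centred variables. -/
theorem sum_prod_weight_mul_sum_sq (hq1 : ∑ z, q z = 1) {g : Z → ℝ} (hg : ∑ z, q z * g z = 0)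
    (K : ℕ) : ∑ z : Fin K → Z, (∏ k, q (z k)) * (∑ k, g (z k)) ^ 2 =
      K * ∑ z, q z * g z ^ 2 := by
  induction K with
  | zero => simp
  | succ K ih =>
    rw [sum_fin_succ_pi]
    have h : ∀ z : Fin K → Z, ∑ y, (∏ k, q ((Fin.cons y z : Fin (K + 1) → Z) k)) *
        (∑ k, g ((Fin.cons y z : Fin (K + 1) → Z) k)) ^ 2 =
        (∏ k, q (z k)) * (∑ y, q y * g y ^ 2) + (∏ k, q (z k)) * (∑ k, g (z k)) ^ 2 := fun z => by
      simp only [Fin.prod_univ_succ, Fin.sum_univ_succ, Fin.cons_zero, Fin.cons_succ]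
      calc _ = ∑ y, ((q y * g y ^ 2) * (∏ k, q (z k))
              + (q y * g y) * (2 * (∏ k, q (z k)) * ∑ k, g (z k))
              + q y * ((∏ k, q (z k)) * (∑ k, g (z k)) ^ 2)) :=
            Finset.sum_congr rfl fun y _ => by ring
        _ = _ := by
            rw [Finset.sum_add_distrib, Finset.sum_add_distrib, ← Finset.sum_mul,
              ← Finset.sum_mul, ← Finset.sum_mul, hg, hq1]; ring
    simp_rw [h]
    rw [Finset.sum_add_distrib, ih, ← Finset.sum_mul, sum_prod_weight hq1]
    push_cast
    ring

variable {E : Type*} [NormedAddCommGroup E] [InnerProductSpace ℂ E] [FiniteDimensional ℂ E]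

/-- The matrix Laplace transform bound for a sum of independent, identically distributed, centred
random operators that are multiples of isometries. -/
theorem sum_prod_weight_mul_traceCosh_le (hq : ∀ z, 0 ≤ q z) (hq1 : ∑ z, q z = 1)
    {X : Z → E →ₗ[ℂ] E} {b : Z → ℝ} (hX : ∀ z, (X z).IsSymmetric)
    (hXb : ∀ z x, ‖X z x‖ = b z * ‖x‖) (hb : ∀ z, 0 ≤ b z) (hb4 : ∀ z, b z ≤ 1 / 4)
    (hmean : ∑ z, q z • X z = 0) (K : ℕ) :
    ∑ z : Fin K → Z, (∏ k, q (z k)) * traceCosh (∑ k, X (z k)) ≤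
      Module.finrank ℂ E * (1 + 3 * ∑ z, q z * b z ^ 2) ^ K := by
  induction K with
  | zero => simp [traceCosh_zero]
  | succ K ih =>
    have hV : 0 ≤ 1 + 3 * ∑ z, q z * b z ^ 2 := by
      have : 0 ≤ ∑ z, q z * b z ^ 2 :=
        Finset.sum_nonneg fun z _ => mul_nonneg (hq z) (sq_nonneg _)
      linarith
    rw [sum_fin_succ_pi, pow_succ, ← mul_assoc]
    refine le_trans ?_ (mul_le_mul_of_nonneg_right ih hV)
    rw [Finset.sum_mul]
    refine Finset.sum_le_sum fun z _ => ?_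
    simp only [Fin.prod_univ_succ, Fin.sum_univ_succ, Fin.cons_zero, Fin.cons_succ]
    set H := ∑ k, X (z k)
    have hH : H.IsSymmetric := by
      refine Finset.sum_induction _ (fun T : E →ₗ[ℂ] E => T.IsSymmetric)
        (fun _ _ ha hb => ha.add hb) LinearMap.IsSymmetric.zero fun k _ => hX (z k)
    -- `H` is the sum over the other `K` draws, so `L` does not see the new draw `y` and averages to
    -- zero over it.
    obtain ⟨L, hL⟩ := exists_traceCosh_add_le hH
    have hL0 : ∑ y, q y * L (X y) = 0 := by
      rw [← map_zero L, ← hmean, map_sum]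
      exact Finset.sum_congr rfl fun y _ => by rw [map_smul, smul_eq_mul]
    have hP : 0 ≤ ∏ k, q (z k) := Finset.prod_nonneg fun k _ => hq _
    calc ∑ y, (q y * ∏ k, q (z k)) * traceCosh (X y + H)
        ≤ ∑ y, (q y * ∏ k, q (z k)) * ((1 + 3 * b y ^ 2) * traceCosh H + L (X y)) := by
          refine Finset.sum_le_sum fun y _ => ?_
          rw [add_comm]
          exact mul_le_mul_of_nonneg_left (hL _ _ (hX y) (hXb y) (hb y) (hb4 y))
            (mul_nonneg (hq y) hP)
      _ = ∑ y, (q y * ((∏ k, q (z k)) * traceCosh H)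
            + (q y * b y ^ 2) * (3 * (∏ k, q (z k)) * traceCosh H)
            + (q y * L (X y)) * (∏ k, q (z k))) :=
          Finset.sum_congr rfl fun y _ => by ring
      _ = _ := by
          rw [Finset.sum_add_distrib, Finset.sum_add_distrib, ← Finset.sum_mul, ← Finset.sum_mul,
            ← Finset.sum_mul, hL0, hq1]
          ring

open Classical in
/-- The tail bound that follows from the matrix Laplace transform bound. -/
theorem sum_prod_weight_filter_norm_le (hq : ∀ z, 0 ≤ q z) (hq1 : ∑ z, q z = 1)
    {X : Z → E →L[ℂ] E} {b : Z → ℝ} (hX : ∀ z, (X z : E →ₗ[ℂ] E).IsSymmetric)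
    (hXb : ∀ z x, ‖X z x‖ = b z * ‖x‖) (hb : ∀ z, 0 ≤ b z) (hb4 : ∀ z, b z ≤ 1 / 4)
    (hmean : ∑ z, q z • X z = 0) {v : ℝ} (hv : ∑ z, q z * b z ^ 2 ≤ v) (K : ℕ) {r : ℝ}
    (hr : 0 ≤ r) :
    ∑ z : Fin K → Z with r < ‖∑ k, X (z k)‖, ∏ k, q (z k) ≤
      2 * Module.finrank ℂ E * Real.exp (3 * v * K - r) := by
  have hsymm : ∀ z : Fin K → Z, ((∑ k, X (z k) : E →L[ℂ] E) : E →ₗ[ℂ] E).IsSymmetric := fun z => by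
    rw [ContinuousLinearMap.toLinearMap_sum]
    exact Finset.sum_induction _ (fun T : E →ₗ[ℂ] E => T.IsSymmetric)
      (fun _ _ ha hb => ha.add hb) LinearMap.IsSymmetric.zero fun k _ => hX (z k)
  have hmean' : ∑ z, q z • (X z : E →ₗ[ℂ] E) = 0 := by
    have := congrArg (fun T : E →L[ℂ] E => (T : E →ₗ[ℂ] E)) hmean
    simpa using this
  have h1 : (∑ z : Fin K → Z with r < ‖∑ k, X (z k)‖, ∏ k, q (z k)) * Real.cosh r ≤
      Module.finrank ℂ E * (1 + 3 * ∑ z, q z * b z ^ 2) ^ K := by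
    refine le_trans ?_ (sum_prod_weight_mul_traceCosh_le hq hq1 hX hXb hb hb4 hmean' K)
    rw [Finset.sum_mul, Finset.sum_filter]
    refine Finset.sum_le_sum fun z _ => ?_
    have hP : 0 ≤ ∏ k, q (z k) := Finset.prod_nonneg fun k _ => hq _
    rw [← ContinuousLinearMap.toLinearMap_sum]
    split_ifs with h
    · exact mul_le_mul_of_nonneg_left (cosh_opNorm_le_traceCosh (hsymm z) hr h) hP
    · refine mul_nonneg hP ?_
      rw [traceCosh_eq (hsymm z)]
      exact Finset.sum_nonneg fun _ _ => (Real.cosh_pos _).le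
  have h2 : (1 + 3 * ∑ z, q z * b z ^ 2) ^ K ≤ Real.exp (3 * v * K) := by
    have h0 : 0 ≤ ∑ z, q z * b z ^ 2 :=
      Finset.sum_nonneg fun z _ => mul_nonneg (hq z) (sq_nonneg _)
    rw [mul_comm (3 * v), Real.exp_nat_mul]
    refine pow_le_pow_left₀ (by linarith) ?_ K
    have := Real.add_one_le_exp (3 * v)
    linarith
  -- Source of the factor 2 in the tail bound.
  have h3 : Real.exp r / 2 ≤ Real.cosh r := by
    rw [Real.cosh_eq]
    have := Real.exp_pos (-r)
    linarith
  have hS : 0 ≤ ∑ z : Fin K → Z with r < ‖∑ k, X (z k)‖, ∏ k, q (z k) :=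
    Finset.sum_nonneg fun z _ => Finset.prod_nonneg fun k _ => hq _
  have h4 := (mul_le_mul_of_nonneg_left h3 hS).trans
    (h1.trans (mul_le_mul_of_nonneg_left h2 (Nat.cast_nonneg _)))
  rw [Real.exp_sub, ← mul_div_assoc, le_div_iff₀ (Real.exp_pos r)]
  linarith

end FiniteProductWeights

/-! ### Pauli matrices and their product measurements -/

section Pauli

theorem tensor_mul {n : ℕ} (A B : Fin n → Matrix (Fin 2) (Fin 2) ℂ) :
    tensor A * tensor B = tensor fun l => A l * B l := by
  ext i j
  simp only [tensor, Matrix.mul_apply, Matrix.of_apply, Finset.prod_univ_sum,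
    ← Finset.prod_mul_distrib, Fintype.piFinset_univ]

theorem tensor_one {n : ℕ} : tensor (fun _ : Fin n => (1 : Matrix (Fin 2) (Fin 2) ℂ)) = 1 := by
  ext i j
  simp only [tensor, Matrix.of_apply, Matrix.one_apply, Finset.prod_ite_zero, Finset.prod_const_one,
    Finset.mem_univ, true_implies, funext_iff]

theorem tensor_conjTranspose {n : ℕ} (A : Fin n → Matrix (Fin 2) (Fin 2) ℂ) :
    (tensor A).conjTranspose = tensor fun l => (A l).conjTranspose := by
  ext i j
  simp [tensor, Matrix.conjTranspose_apply]

/-- Multilinearity of the tensor product. It reduces both the completeness of the POVM and the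
expansion of `W_w` to a single qubit. -/
theorem sum_smul_tensor {n : ℕ} (c : Fin n → Fin 2 → ℝ)
    (A : Fin n → Fin 2 → Matrix (Fin 2) (Fin 2) ℂ) :
    ∑ j : Fin n → Fin 2, (∏ l, c l (j l)) • tensor (fun l => A l (j l)) =
      tensor fun l => ∑ s, c l s • A l s := by
  ext x y
  simp only [tensor, Matrix.sum_apply, Matrix.smul_apply, Matrix.of_apply, Finset.prod_univ_sum,
    Fintype.piFinset_univ, Complex.real_smul, Finset.prod_mul_distrib, Complex.ofReal_prod]

theorem sigma_mul_self (i : Fin 4) : sigma i * sigma i = 1 := by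
  fin_cases i <;> ext a b <;> fin_cases a <;> fin_cases b <;> simp [sigma, Matrix.mul_apply]

theorem sigma_conjTranspose (i : Fin 4) : (sigma i).conjTranspose = sigma i := by
  fin_cases i <;> ext a b <;> fin_cases a <;> fin_cases b <;>
    simp [sigma, Matrix.conjTranspose_apply]

theorem invSqrtTwo_mul_self : invSqrtTwo * invSqrtTwo = 1 / 2 := by
  rw [invSqrtTwo, ← Complex.ofReal_mul, div_mul_div_comm, Real.mul_self_sqrt (by norm_num)]
  norm_num

theorem conj_invSqrtTwo : (starRingEnd ℂ) invSqrtTwo = invSqrtTwo := Complex.conj_ofReal _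

theorem invSqrtTwo_mul_I_mul : Complex.I * invSqrtTwo * (Complex.I * invSqrtTwo) = -(1 / 2) := by
  rw [mul_mul_mul_comm, Complex.I_mul_I, invSqrtTwo_mul_self, neg_one_mul]

theorem localPOVM_apply (i : Fin 4) (s a b : Fin 2) :
    localPOVM i s a b = localVec i s a * (starRingEnd ℂ) (localVec i s b) := rfl

theorem sum_localPOVM (i : Fin 4) : ∑ s, localPOVM i s = 1 := by
  ext a b
  simp only [Fin.sum_univ_two, Matrix.add_apply, localPOVM_apply]
  fin_cases i <;> fin_cases a <;> fin_cases b <;>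
    simp [localVec, conj_invSqrtTwo, invSqrtTwo_mul_self, invSqrtTwo_mul_I_mul] <;> ring

theorem sum_localCoeff_smul_localPOVM (i : Fin 4) :
    ∑ s, localCoeff i s • localPOVM i s = sigma i := by
  ext a b
  have h := invSqrtTwo_mul_self
  simp only [Fin.sum_univ_two, Matrix.add_apply, Matrix.smul_apply, localPOVM_apply]
  fin_cases i <;> fin_cases a <;> fin_cases b <;>
    simp [localVec, localCoeff, sigma, conj_invSqrtTwo, invSqrtTwo_mul_self,
      invSqrtTwo_mul_I_mul] <;> first | ring1 | linear_combination (2 * Complex.I) * h |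
        linear_combination (-2 * Complex.I) * h

theorem localCoeff_sq (i : Fin 4) (s : Fin 2) : localCoeff i s ^ 2 = 1 := by
  fin_cases i <;> fin_cases s <;> simp [localCoeff]

variable {n : ℕ}

theorem pauli_mul_self (w : PauliIndex n) : pauli w * pauli w = 1 := by
  simp_rw [pauli, tensor_mul, sigma_mul_self, tensor_one]

theorem pauli_conjTranspose (w : PauliIndex n) : (pauli w).conjTranspose = pauli w := by
  simp_rw [pauli, tensor_conjTranspose, sigma_conjTranspose]

theorem sum_povm (w : PauliIndex n) : ∑ j, povm w j = 1 := by
  have h := sum_smul_tensor (fun _ _ => 1) fun l => localPOVM (w l)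
  simp_rw [Finset.prod_const_one, one_smul, sum_localPOVM, tensor_one] at h
  exact h

theorem sum_coeff_smul_povm (w : PauliIndex n) : ∑ j, coeff w j • povm w j = pauli w := by
  have h := sum_smul_tensor (fun l => localCoeff (w l)) fun l => localPOVM (w l)
  simp_rw [sum_localCoeff_smul_localPOVM] at h
  exact h

theorem coeff_sq (w : PauliIndex n) (j : Outcome n) : coeff w j ^ 2 = 1 := by
  simp_rw [coeff, ← Finset.prod_pow, localCoeff_sq, Finset.prod_const_one]

theorem povm_eq_vecMulVec (w : PauliIndex n) (j : Outcome n) :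
    povm w j = Matrix.vecMulVec (fun x => ∏ l, localVec (w l) (j l) (x l))
      (star fun x => ∏ l, localVec (w l) (j l) (x l)) := by
  ext x y
  simp [povm, tensor, localPOVM, Matrix.vecMulVec_apply, Finset.prod_mul_distrib]

variable {ρ : Matrix (Qubits n) (Qubits n) ℂ}

theorem outcomeProb_nonneg (hρ : ρ.PosSemidef) (w : PauliIndex n) (j : Outcome n) :
    0 ≤ outcomeProb ρ w j := by
  rw [outcomeProb, innerRe, povm_eq_vecMulVec, Matrix.conjTranspose_vecMulVec, star_star,
    Matrix.vecMulVec_mul, Matrix.trace_vecMulVec, dotProduct_comm, ← Matrix.dotProduct_mulVec]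
  exact (Complex.le_def.mp (hρ.dotProduct_mulVec_nonneg _)).1

theorem innerRe_sum_smul {ι : Type*} [Fintype ι] (c : ι → ℝ)
    (A : ι → Matrix (Qubits n) (Qubits n) ℂ) (B : Matrix (Qubits n) (Qubits n) ℂ) :
    innerRe (∑ i, c i • A i) B = ∑ i, c i * innerRe (A i) B := by
  simp [innerRe, Matrix.conjTranspose_sum, Matrix.sum_mul, Matrix.trace_sum, Complex.re_sum]

theorem sum_outcomeProb (hρ : IsDensityMatrix ρ) (w : PauliIndex n) :
    ∑ j, outcomeProb ρ w j = 1 := by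
  have h := innerRe_sum_smul (fun _ => 1) (povm w) ρ
  simp_rw [one_smul, one_mul, sum_povm] at h
  simp_rw [outcomeProb, ← h, innerRe]
  simp [hρ.trace_eq_one]

theorem sum_outcomeProb_mul_coeff (w : PauliIndex n) :
    ∑ j, outcomeProb ρ w j * coeff w j = innerRe (pauli w) ρ := by
  rw [← sum_coeff_smul_povm, innerRe_sum_smul]
  exact Finset.sum_congr rfl fun j _ => mul_comm _ _

theorem abs_coeff (w : PauliIndex n) (j : Outcome n) : |coeff w j| = 1 := by
  rw [← sq_eq_sq₀ (abs_nonneg _) zero_le_one, sq_abs, coeff_sq, one_pow]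

theorem abs_innerRe_pauli_le_one (hρ : IsDensityMatrix ρ) (w : PauliIndex n) :
    |innerRe (pauli w) ρ| ≤ 1 := by
  rw [← sum_outcomeProb_mul_coeff, ← sum_outcomeProb hρ w]
  refine (Finset.abs_sum_le_sum_abs _ _).trans (Finset.sum_le_sum fun j _ => ?_)
  rw [abs_mul, abs_coeff, mul_one, abs_of_nonneg (outcomeProb_nonneg hρ.posSemidef w j)]

theorem sum_outcomeProb_mul_deviation (hρ : IsDensityMatrix ρ) (w : PauliIndex n) :
    ∑ j, outcomeProb ρ w j * (coeff w j - innerRe (pauli w) ρ) = 0 := by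
  simp_rw [mul_sub, Finset.sum_sub_distrib, ← Finset.sum_mul]
  rw [sum_outcomeProb_mul_coeff, sum_outcomeProb hρ, one_mul, sub_self]

/-- A random sign with mean `m` has variance `1 - m²`. -/
theorem sum_outcomeProb_mul_deviation_sq_le_one (hρ : IsDensityMatrix ρ) (w : PauliIndex n) :
    ∑ j, outcomeProb ρ w j * (coeff w j - innerRe (pauli w) ρ) ^ 2 ≤ 1 := by
  have h : ∀ j, outcomeProb ρ w j * (coeff w j - innerRe (pauli w) ρ) ^ 2 =
      outcomeProb ρ w j * (1 + innerRe (pauli w) ρ ^ 2)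
        - outcomeProb ρ w j * coeff w j * (2 * innerRe (pauli w) ρ) := fun j => by
    rw [sub_sq, coeff_sq]; ring
  simp_rw [h, Finset.sum_sub_distrib, ← Finset.sum_mul]
  rw [sum_outcomeProb_mul_coeff, sum_outcomeProb hρ]
  nlinarith [sq_nonneg (innerRe (pauli w) ρ)]

theorem isSymmetric_pauli (w : PauliIndex n) :
    (Matrix.toEuclideanCLM (n := Qubits n) (𝕜 := ℂ) (pauli w) :
      EuclideanSpace ℂ (Qubits n) →ₗ[ℂ] EuclideanSpace ℂ (Qubits n)).IsSymmetric :=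
  Matrix.isSymmetric_toEuclideanLin_iff.mpr (pauli_conjTranspose w)

/-- A Hermitian matrix with square one is unitary; this supplies the isometry hypothesis of the
trace bound. -/
theorem norm_pauli_apply (w : PauliIndex n) (x : EuclideanSpace ℂ (Qubits n)) :
    ‖Matrix.toEuclideanCLM (n := Qubits n) (𝕜 := ℂ) (pauli w) x‖ = ‖x‖ := by
  set T := Matrix.toEuclideanCLM (n := Qubits n) (𝕜 := ℂ) (pauli w) with hT
  have h : T (T x) = x := by
    rw [← mul_apply_eq_comp, hT, ← map_mul, pauli_mul_self, map_one,
      one_apply_eq_self]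
  have h2 : inner ℂ (T x) (T x) = inner ℂ x x := (isSymmetric_pauli w x (T x)).trans (by
    change inner ℂ x (T (T x)) = _
    rw [h])
  rw [@norm_eq_sqrt_re_inner ℂ, h2, ← @norm_eq_sqrt_re_inner ℂ]

end Pauli

/-! ### The law of the statistical error and the tail of its adjoint image -/

section PauliExperiment

variable {n K M : ℕ} {ρ : Matrix (Qubits n) (Qubits n) ℂ}

/-- The probability of a label together with the outcomes of its `M` measurements. -/
noncomputable def blockWeight (ρ : Matrix (Qubits n) (Qubits n) ℂ)
    (z : PauliIndex n × (Fin M → Outcome n)) : ℝ :=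
  1 / (4 : ℝ) ^ n * ∏ m, outcomeProb ρ z.1 (z.2 m)

/-- The statistical error that results from a label and the outcomes of its `M` measurements. -/
noncomputable def blockError (ρ : Matrix (Qubits n) (Qubits n) ℂ)
    (z : PauliIndex n × (Fin M → Outcome n)) : ℝ :=
  (∑ m, (coeff z.1 (z.2 m) - innerRe (pauli z.1) ρ)) / M

theorem sum_coeff_mul_empiricalProb (w : PauliIndex n) (o : Fin M → Outcome n) :
    ∑ j, coeff w j * empiricalProb o j = (∑ m, coeff w (o m)) / M := by
  simp_rw [empiricalProb, frequency, ← mul_div_assoc, ← Finset.sum_div, Finset.card_filter,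
    Nat.cast_sum, Nat.cast_ite, Nat.cast_one, Nat.cast_zero, Finset.mul_sum]
  rw [Finset.sum_comm]
  simp

theorem statError_eq_blockError (hM : 1 ≤ M) (w : Fin K → PauliIndex n)
    (o : Fin K → Fin M → Outcome n) (k : Fin K) :
    statError ρ w o k = blockError ρ (w k, o k) := by
  have hM' : (M : ℝ) ≠ 0 := by positivity
  rw [statError, empiricalMeasure, sum_coeff_mul_empiricalProb, PauliTomography.measure, blockError,
    Finset.sum_sub_distrib, sub_div]
  simp [hM']

theorem blockWeight_nonneg (hρ : ρ.PosSemidef) (z : PauliIndex n × (Fin M → Outcome n)) :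
    0 ≤ blockWeight ρ z :=
  mul_nonneg (by positivity) (Finset.prod_nonneg fun _ _ => outcomeProb_nonneg hρ _ _)

theorem sum_pauliIndex_const (n : ℕ) (c : ℝ) : ∑ _w : PauliIndex n, 1 / (4 : ℝ) ^ n * c = c := by
  rw [Finset.sum_const, Finset.card_univ, Fintype.card_pi, nsmul_eq_mul]
  simp

theorem sum_blockWeight (hρ : IsDensityMatrix ρ) :
    ∑ z : PauliIndex n × (Fin M → Outcome n), blockWeight ρ z = 1 := by
  rw [Fintype.sum_prod_type, ← sum_pauliIndex_const n 1]
  refine Finset.sum_congr rfl fun w _ => ?_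
  exact (Finset.mul_sum _ _ _).symm.trans
    (congrArg _ (sum_prod_weight (sum_outcomeProb hρ w) M))

/-- The error is centred conditionally on the label, so weighting it by anything that depends on the
label alone still gives mean zero. -/
theorem sum_blockWeight_mul_blockError_smul (hρ : IsDensityMatrix ρ) {V : Type*} [AddCommGroup V]
    [Module ℝ V] (A : PauliIndex n → V) :
    ∑ z : PauliIndex n × (Fin M → Outcome n), (blockWeight ρ z * blockError ρ z) • A z.1 = 0 := by
  rw [Fintype.sum_prod_type]
  refine Finset.sum_eq_zero fun w _ => ?_
  dsimp only
  rw [← Finset.sum_smul]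
  have h := sum_prod_weight_mul_sum (sum_outcomeProb hρ w) (sum_outcomeProb_mul_deviation hρ w) M
  have h2 : ∑ x : Fin M → Outcome n, blockWeight ρ (w, x) * blockError ρ (w, x) = 0 := by
    rw [← mul_zero (1 / (4 : ℝ) ^ n / M), ← h, Finset.mul_sum]
    refine Finset.sum_congr rfl fun x _ => ?_
    rw [blockWeight, blockError]
    ring
  rw [h2, zero_smul]

/-- For each fixed label the error averages `M` independent centred variables of variance at most
one; the uniform average over labels preserves the bound. -/
theorem sum_blockWeight_mul_blockError_sq_le (hρ : IsDensityMatrix ρ) (hM : 1 ≤ M) :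
    ∑ z : PauliIndex n × (Fin M → Outcome n), blockWeight ρ z * blockError ρ z ^ 2 ≤ 1 / M := by
  have hM' : (0 : ℝ) < M := by positivity
  rw [Fintype.sum_prod_type]
  refine (Finset.sum_le_sum fun w _ => ?_).trans (sum_pauliIndex_const n (1 / (M : ℝ))).le
  have h := sum_prod_weight_mul_sum_sq (sum_outcomeProb hρ w)
    (sum_outcomeProb_mul_deviation hρ w) M
  have h2 : ∑ x : Fin M → Outcome n, blockWeight ρ (w, x) * blockError ρ (w, x) ^ 2 =
      1 / (4 : ℝ) ^ n / M ^ 2 * (M * ∑ j, outcomeProb ρ w j *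
        (coeff w j - innerRe (pauli w) ρ) ^ 2) := by
    rw [← h, Finset.mul_sum]
    refine Finset.sum_congr rfl fun x _ => ?_
    rw [blockWeight, blockError]
    ring
  rw [h2]
  calc _ ≤ 1 / (4 : ℝ) ^ n / M ^ 2 * (M * 1) := by
        gcongr
        exact sum_outcomeProb_mul_deviation_sq_le_one hρ w
    _ = _ := by field_simp

theorem abs_blockError_le_two (hρ : IsDensityMatrix ρ) (hM : 1 ≤ M)
    (z : PauliIndex n × (Fin M → Outcome n)) : |blockError ρ z| ≤ 2 := by
  have hM' : (0 : ℝ) < M := by positivity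
  rw [blockError, abs_div, abs_of_pos hM', div_le_iff₀ hM']
  refine (Finset.abs_sum_le_sum_abs _ _).trans ?_
  calc _ ≤ ∑ _m : Fin M, (2 : ℝ) := Finset.sum_le_sum fun m _ => by
        refine (abs_sub _ _).trans ?_
        rw [abs_coeff]
        linarith [abs_innerRe_pauli_le_one hρ z.1]
    _ = _ := by simp [mul_comm]

theorem specNorm_measureAdjoint (w : Fin K → PauliIndex n) (x : Fin K → ℝ) :
    specNorm (measureAdjoint w x) =
      ‖∑ k, x k • Matrix.toEuclideanCLM (n := Qubits n) (𝕜 := ℂ) (pauli (w k))‖ := by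
  rw [specNorm, measureAdjoint, map_sum]
  simp_rw [map_smul]
  rfl

open Classical in
/-- The tail bound for `𝒜^*(e)` in terms of the weights of the possible results of the
experiment. -/
theorem sum_blockWeight_filter_le (hρ : IsDensityMatrix ρ) (hM : 1 ≤ M) (K : ℕ) {θ t : ℝ}
    (hθ : 0 < θ) (hθ8 : θ ≤ 1 / 8) (ht : 0 ≤ t) :
    ∑ z : Fin K → PauliIndex n × (Fin M → Outcome n) with
        t < specNorm (measureAdjoint (fun k => (z k).1) fun k => blockError ρ (z k)),
      ∏ k, blockWeight ρ (z k) ≤ 2 * 2 ^ n * Real.exp (3 * (θ ^ 2 / M) * K - θ * t) := by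
  let X : PauliIndex n × (Fin M → Outcome n) →
      EuclideanSpace ℂ (Qubits n) →L[ℂ] EuclideanSpace ℂ (Qubits n) := fun z =>
    (θ * blockError ρ z) • Matrix.toEuclideanCLM (n := Qubits n) (𝕜 := ℂ) (pauli z.1)
  have hmean : ∑ z, blockWeight ρ z • X z = 0 := by
    have h := sum_blockWeight_mul_blockError_smul (M := M) hρ fun w =>
      θ • Matrix.toEuclideanCLM (n := Qubits n) (𝕜 := ℂ) (pauli w)
    rw [← h]
    refine Finset.sum_congr rfl fun z _ => ?_
    simp only [X, smul_smul]
    congr 1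
    ring
  have hvar : ∑ z : PauliIndex n × (Fin M → Outcome n),
      blockWeight ρ z * (θ * |blockError ρ z|) ^ 2 ≤ θ ^ 2 / M := by
    have h := mul_le_mul_of_nonneg_left (sum_blockWeight_mul_blockError_sq_le hρ hM)
      (sq_nonneg θ)
    rw [Finset.mul_sum, mul_one_div] at h
    refine le_trans (le_of_eq (Finset.sum_congr rfl fun z _ => ?_)) h
    rw [mul_pow, sq_abs]
    ring
  have h := sum_prod_weight_filter_norm_le (blockWeight_nonneg hρ.posSemidef)
    (sum_blockWeight hρ) (X := X) (b := fun z => θ * |blockError ρ z|)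
    (fun z => by
      have := (isSymmetric_pauli z.1).smul (c := ((θ * blockError ρ z : ℝ) : ℂ))
        (Complex.conj_ofReal _)
      intro x y
      exact this x y)
    (fun z x => by
      simp only [X, smul_apply, norm_smul, norm_pauli_apply, Real.norm_eq_abs,
        abs_mul, abs_of_pos hθ])
    (fun z => by positivity)
    -- `|e_k| ≤ 2` and `θ ≤ 1/8` give the step size `1/4` that the trace bound allows.
    (fun z => by
      have := abs_blockError_le_two hρ hM z
      nlinarith [abs_nonneg (blockError ρ z)])
    hmean hvar K (r := θ * t) (by positivity)
  have hdim : (Module.finrank ℂ (EuclideanSpace ℂ (Qubits n)) : ℝ) = 2 ^ n := by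
    simp
  rw [hdim] at h
  refine le_trans (le_of_eq (Finset.sum_congr (Finset.filter_congr fun z _ => ?_) fun _ _ => rfl)) h
  rw [specNorm_measureAdjoint]
  simp_rw [X, mul_smul, ← Finset.smul_sum, norm_smul, Real.norm_eq_abs, abs_of_pos hθ]
  exact (mul_lt_mul_iff_right₀ hθ).symm

variable {Ω : Type*} [MeasurableSpace Ω] {P : Measure Ω}

/-- Independence of the labels and the conditional law of the outcomes combine into a product over
`k`, so that probabilities on `Ω` become finite sums of product weights. -/
theorem PauliTomography.IsPauliExperiment.measureReal_eq_prod {a : Fin K → Ω → PauliIndex n}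
    {o : Fin K → Fin M → Ω → Outcome n} (h : IsPauliExperiment P ρ a o)
    (z : Fin K → PauliIndex n × (Fin M → Outcome n)) :
    P.real ((fun ω k => (a k ω, fun m => o k m ω)) ⁻¹' {z}) = ∏ k, blockWeight ρ (z k) := by
  have h1 : P.real {ω | ∀ k, a k ω = (z k).1} = ∏ _k : Fin K, 1 / (4 : ℝ) ^ n := by
    have h2 := h.label_indep.measure_inter_preimage_eq_mul Finset.univ
      (sets := fun k => {(z k).1}) fun k _ => measurableSet_singleton _
    have h3 : {ω | ∀ k, a k ω = (z k).1} = ⋂ k ∈ Finset.univ, a k ⁻¹' {(z k).1} := by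
      ext ω; simp
    rw [h3, measureReal_def, h2, ENNReal.toReal_prod]
    exact Finset.prod_congr rfl fun k _ => h.label_uniform k (z k).1
  have h4 : (fun ω k => (a k ω, fun m => o k m ω)) ⁻¹' {z} =
      {ω | (∀ k, a k ω = (z k).1) ∧ ∀ k m, o k m ω = (z k).2 m} := by
    ext ω
    simp [funext_iff, Prod.ext_iff, forall_and]
  rw [h4, h.outcome_law (fun k => (z k).1) fun k m => (z k).2 m, h1, ← Finset.prod_mul_distrib]
  rfl

open Classical in
theorem PauliTomography.IsPauliExperiment.measureReal_setOf [IsProbabilityMeasure P]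
    {a : Fin K → Ω → PauliIndex n}
    {o : Fin K → Fin M → Ω → Outcome n} (h : IsPauliExperiment P ρ a o)
    (Q : (Fin K → PauliIndex n × (Fin M → Outcome n)) → Prop) :
    P.real {ω | Q fun k => (a k ω, fun m => o k m ω)} =
      1 - ∑ z with ¬ Q z, ∏ k, blockWeight ρ (z k) := by
  have hY : Measurable fun ω k => (a k ω, fun m => o k m ω) :=
    measurable_pi_lambda _ fun k => (h.measurable_label k).prodMk
      (measurable_pi_lambda _ fun m => h.measurable_outcome k m)
  have h1 := sum_measureReal_preimage_singleton (μ := P) (Finset.univ.filter fun z => ¬ Q z)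
    (f := fun ω k => (a k ω, fun m => o k m ω)) fun z _ => hY (measurableSet_singleton z)
  simp_rw [h.measureReal_eq_prod] at h1
  have hms : MeasurableSet {ω | Q fun k => (a k ω, fun m => o k m ω)} :=
    hY (Set.toFinite {z | Q z}).measurableSet
  rw [h1, ← compl_compl {ω | Q fun k => (a k ω, fun m => o k m ω)},
    probReal_compl_eq_one_sub hms.compl]
  congr 2
  ext ω
  simp

end PauliExperiment

theorem mainTheorem4 :
    ∃ c : ℝ, 0 < c ∧ ∀ C₀ : ℝ, 0 < C₀ → ∃ C : ℝ, 0 < C ∧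
      ∀ (n K M : ℕ), 1 ≤ n → 1 ≤ K → 1 ≤ M → (M : ℝ) ≤ C₀ * ((K : ℝ) / n) →
      ∀ (ρ : Matrix (Qubits n) (Qubits n) ℂ), IsDensityMatrix ρ →
      ∀ {Ω : Type*} [MeasurableSpace Ω] (P : Measure Ω) [IsProbabilityMeasure P]
        (a : Fin K → Ω → PauliIndex n) (o : Fin K → Fin M → Ω → Outcome n),
        IsPauliExperiment P ρ a o →
        1 - Real.exp (-(c * (n / (1 + Real.sqrt (M * n / K))))) ≤
          P.real {ω | specNorm (measureAdjoint (fun k => a k ω)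
                (statError ρ (fun k => a k ω) (fun k m => o k m ω))) / K ≤
              C * Real.sqrt (Real.log ((2 : ℝ) ^ n) / (K * M))} := by
  classical
  refine ⟨1, one_pos, fun C₀ hC₀ => ?_⟩
  -- The Laplace parameter will be `θ = β s` with `s = √(Mn/K) ≤ √C₀`; this `β` ensures `θ ≤ 1/8`.
  set β : ℝ := 1 / (8 * (1 + Real.sqrt C₀)) with hβ
  have hβ0 : 0 < β := by positivity
  have hβ8 : β ≤ 1 / 8 := by
    rw [hβ]
    gcongr
    linarith [Real.sqrt_nonneg C₀]
  have hlog : 0 < Real.log 2 := Real.log_pos one_lt_two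
  -- Chosen so that `θt` is exactly `3n`.
  refine ⟨3 / (β * Real.sqrt (Real.log 2)), by positivity, ?_⟩
  intro n K M hn hK hM hMK ρ hρ Ω _ P _ a o h
  have hn' : (1 : ℝ) ≤ n := by exact_mod_cast hn
  have hK' : (0 : ℝ) < K := by exact_mod_cast hK
  have hM' : (0 : ℝ) < M := by exact_mod_cast hM
  have hn0 : (0 : ℝ) < n := by linarith
  set s : ℝ := Real.sqrt (M * n / K) with hs
  have hs0 : 0 < s := by positivity
  have hs2 : s ^ 2 = M * n / K := Real.sq_sqrt (by positivity)
  have hsC : s ≤ Real.sqrt C₀ := by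
    refine Real.sqrt_le_sqrt ?_
    rw [div_le_iff₀ hK']
    rw [← mul_div_assoc, le_div_iff₀ hn0] at hMK
    exact hMK
  set t : ℝ := 3 / (β * Real.sqrt (Real.log 2)) *
    Real.sqrt (Real.log ((2 : ℝ) ^ n) / (K * M)) * K with ht
  have ht0 : 0 ≤ t := by positivity
  have hθ8 : β * s ≤ 1 / 8 := by
    have : β * (8 * (1 + Real.sqrt C₀)) = 1 := by rw [hβ]; field_simp
    nlinarith
  have htail := sum_blockWeight_filter_le hρ hM K (mul_pos hβ0 hs0) hθ8 ht0
  have hθt : β * s * t = 3 * n := by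
    have h1 : Real.sqrt (Real.log ((2 : ℝ) ^ n) / (K * M)) =
        Real.sqrt (Real.log 2) * (s / M) := by
      rw [Real.log_pow, mul_comm (n : ℝ), mul_div_assoc, Real.sqrt_mul hlog.le]
      congr 1
      rw [Real.sqrt_eq_iff_eq_sq (by positivity) (by positivity), div_pow, hs2]
      field_simp
    have h2 : β * s * t = 3 * (s ^ 2 * K / M) := by
      rw [ht, h1]
      field_simp
    rw [h2, hs2]
    field_simp
  have hvar : 3 * ((β * s) ^ 2 / M) * K = 3 * β ^ 2 * n := by
    rw [mul_pow, hs2]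
    field_simp
  rw [hθt, hvar] at htail
  have hQ := h.measureReal_setOf fun z =>
    specNorm (measureAdjoint (fun k => (z k).1) fun k => blockError ρ (z k)) ≤ t
  have hset : {ω | specNorm (measureAdjoint (fun k => a k ω)
      (statError ρ (fun k => a k ω) (fun k m => o k m ω))) / K ≤
        3 / (β * Real.sqrt (Real.log 2)) * Real.sqrt (Real.log ((2 : ℝ) ^ n) / (K * M))} =
      {ω | specNorm (measureAdjoint (fun k => a k ω)
        fun k => blockError ρ (a k ω, fun m => o k m ω)) ≤ t} := by
    ext ω
    rw [Set.mem_ofPred_eq, Set.mem_ofPred_eq, div_le_iff₀ hK', ← ht,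
      funext (statError_eq_blockError hM (fun k => a k ω) fun k m => o k m ω)]
  rw [hset, hQ]
  simp_rw [not_le]
  refine sub_le_sub_left (htail.trans ?_) 1
  -- The exponent is `(n + 1) log 2 + 3β²n - 3n`. As `n ≥ 1` and `β² ≤ 1/64`, it is below `-n`,
  -- hence below `-n/(1 + s)`.
  have hlog2 : Real.log 2 < 0.7 := by linarith [Real.log_two_lt_d9]
  have h2 : (2 : ℝ) * 2 ^ n = Real.exp (Real.log 2 + n * Real.log 2) := by
    rw [Real.exp_add, Real.exp_nat_mul, Real.exp_log two_pos]
  rw [h2, ← Real.exp_add, Real.exp_le_exp]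
  have h3 : (n : ℝ) / (1 + s) ≤ n := div_le_self hn0.le (by linarith)
  have h4 : β ^ 2 ≤ 1 / 64 := by nlinarith
  nlinarith [mul_le_mul_of_nonneg_right h4 hn0.le]
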